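/- Let $\mathbb K$ be a field of characteristic $0$, let $V$ be a vector space over $\mathbb K$ (of arbitrary dimension), and let $n,p\ge 1$ be integers. An $n$-Lie algebra (or $n$-Nambu-Lie algebra) $(V,\varphi)$ is the vector space $V$ together with a skew-symmetric $n$-linear map $\varphi:V^n\to V$ satisfying the fundamental identity $$\varphi\bigl(x_1,\dots,x_{n-1},\varphi(y_1,\dots,y_n)\bigr)=\sum_{k=1}^n\varphi\bigl(y_1,\dots,y_{k-1},\varphi(x_1,\dots,x_{n-1},y_k),y_{k+1},\dots,y_n\bigr)$$ for all $x_i,y_j\in V$. A $p$-form on $V$ is a skew-symmetric $p$-linear map $V^p\to\mathbb K$. For a $p$-form $\tau$ and a skew-symmetric $q$-linear map $\psi$ with values in $\mathbb K$ or in $V$, the skew-symmetric $(p+q)$-linear map $\tau\wedge\psi$ is defined by $$(\tau\wedge\psi)(x_1,\dots,x_{p+q})=\frac1{q!\,p!}\sum_{\sigma\in S_{p+q}}\operatorname{sgn}(\sigma)\,\tau(x_{\sigma(1)},\dots,x_{\sigma(p)})\,\psi(x_{\sigma(p+1)},\dots,x_{\sigma(p+q)}),$$ and $i_{x_1\cdots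 x_{p-1}}\tau$ denotes the $1$-form $\tau(x_1,\dots,x_{p-1},\cdot)$. **Proposition 6.5.** Let $(V,\varphi)$ be an $n$-Lie algebra and let $\tau$ be a $p$-form on $V$ such that $$\tau\bigl(\varphi(x_1,\dots,x_n),y_1,\dots,y_{p-1}\bigr)=0\quad\text{for all }x_1,\dots,x_n,y_1,\dots,y_{p-1}\in V,$$ and $$(i_{x_1\cdots x_{p-1}}\tau)\wedge\tau=0\quad\text{for all }x_1,\dots,x_{p-1}\in V.$$ Then $(V,\tau\wedge\varphi)$ is an $(n+p)$-Lie algebra; that is, the skew-symmetric $(n+p)$-linear map $\tau\wedge\varphi:V^{n+p}\to V$ satisfies the fundamental identity. -/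

import Mathlib

namespace NambuLie

variable {K V N : Type*} [Field K] [AddCommGroup V] [Module K V] [AddCommGroup N] [Module K N]

/-- The multilinear map
`(x₁, …, x_{p+q}) ↦ τ(x₁, …, x_p) • ψ(x_{p+1}, …, x_{p+q})`. -/
def outerProduct {p q : ℕ} (τ : V [⋀^Fin p]→ₗ[K] K) (ψ : V [⋀^Fin q]→ₗ[K] N) :
    MultilinearMap K (fun _ : Fin (p + q) => V) N :=
  ((TensorProduct.lift (LinearMap.lsmul K N)).compMultilinearMap
    (τ.toMultilinearMap.domCoprod ψ.toMultilinearMap)).domDomCongr finSumFinEquiv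

theorem outerProduct_apply {p q : ℕ} (τ : V [⋀^Fin p]→ₗ[K] K) (ψ : V [⋀^Fin q]→ₗ[K] N)
    (x : Fin (p + q) → V) :
    outerProduct τ ψ x
      = τ (fun i => x (Fin.castAdd q i)) • ψ (fun j => x (Fin.natAdd p j)) := by
  simp [outerProduct, MultilinearMap.domCoprod_apply]

/-- The wedge product of a `p`-form `τ` with an alternating `q`-linear map `ψ` (scalar or vector
valued); see `wedge_apply` for the explicit formula. -/
noncomputable def wedge {p q : ℕ} (τ : V [⋀^Fin p]→ₗ[K] K) (ψ : V [⋀^Fin q]→ₗ[K] N) :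
    V [⋀^Fin (p + q)]→ₗ[K] N :=
  ((q.factorial : K) * (p.factorial : K))⁻¹ •
    MultilinearMap.alternatization (outerProduct τ ψ)

theorem wedge_apply {p q : ℕ} (τ : V [⋀^Fin p]→ₗ[K] K) (ψ : V [⋀^Fin q]→ₗ[K] N)
    (x : Fin (p + q) → V) :
    wedge τ ψ x = ((q.factorial : K) * (p.factorial : K))⁻¹ •
      ∑ σ : Equiv.Perm (Fin (p + q)), Equiv.Perm.sign σ •
        (τ (fun i => x (σ (Fin.castAdd q i))) • ψ (fun j => x (σ (Fin.natAdd p j)))) := by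
  simp [wedge, MultilinearMap.alternatization_apply, outerProduct_apply]

/-- The `1`-form `i_{x₁⋯x_p} τ = τ(x₁, …, x_p, ·)` obtained from a `(p+1)`-form `τ`. -/
def contract {p : ℕ} (x : Fin p → V) (τ : V [⋀^Fin (p + 1)]→ₗ[K] K) : V [⋀^Fin 1]→ₗ[K] K :=
  AlternatingMap.ofSubsingleton K V K (0 : Fin 1)
    (τ.toMultilinearMap.toLinearMap (Fin.snoc x (0 : V) : Fin (p + 1) → V) (Fin.last p))

theorem contract_apply {p : ℕ} (x : Fin p → V) (τ : V [⋀^Fin (p + 1)]→ₗ[K] K) (v : Fin 1 → V) :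
    contract x τ v = τ (Fin.snoc x (v 0) : Fin (p + 1) → V) := by
  simp [contract, Fin.update_snoc_last]

/-- An alternating `(n+1)`-linear bracket `φ` on `V` makes `(V, φ)` an `(n+1)`-Lie algebra
(also called `(n+1)`-Nambu-Lie algebra): it satisfies the fundamental identity
`[x₁, …, x_n, [y₁, …, y_{n+1}]] = ∑ₖ [y₁, …, y_{k-1}, [x₁, …, x_n, yₖ], y_{k+1}, …, y_{n+1}]`.
The arity is written as `n + 1` since it has to be positive. -/
def IsNLieBracket {n : ℕ} (φ : V [⋀^Fin (n + 1)]→ₗ[K] V) : Prop :=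
  ∀ (x : Fin n → V) (y : Fin (n + 1) → V),
    φ (Fin.snoc x (φ y) : Fin (n + 1) → V)
      = ∑ k : Fin (n + 1),
          φ (Function.update y k (φ (Fin.snoc x (y k) : Fin (n + 1) → V)))

/-- The `(p+1)`-form `τ` is `φ`-compatible: `τ(φ(x₁, …, x_n), y₁, …, y_p) = 0` for all
`x₁, …, x_n, y₁, …, y_p`. -/
def IsCompatible {n p : ℕ} (φ : V [⋀^Fin n]→ₗ[K] V) (τ : V [⋀^Fin (p + 1)]→ₗ[K] K) : Prop :=
  ∀ (x : Fin n → V) (y : Fin p → V), τ (Fin.cons (φ x) y : Fin (p + 1) → V) = 0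

end NambuLie

/-!
The fundamental identity says that every one-slot map `φ(x₁, …, x_n, ·)` is a derivation of `φ`. A
one-slot map of `τ ∧ φ` is a linear combination of maps `c • φ(…, ·, …)` and `τ(…, ·, …) • w` with
`w` a value of `φ`. Both take values in the radical of `τ`, so along such a map `L` the Leibniz rule
reads `𝓛_L (τ ∧ φ) = τ ∧ 𝓛_L φ`. For the first kind, `𝓛_L φ = L ∘ φ` since `φ` is a bracket. For the
second kind, with `α = τ(…, ·, …)`, `L` vanishes on the values of `φ`, while `𝓛_L φ = α ∧ i_w φ` is
killed by `τ` because `α ∧ τ = 0`.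
-/

namespace NambuLie

open Equiv Function

theorem sum_eq_zero_of_sum_mul_eq_zero {G H A : Type*} [Group G] [Fintype G] [Group H] [Fintype H]
    [AddCommMonoid A] {f : H →* G} (hf : Injective f) {F : G → A}
    (hF : ∀ g, ∑ h, F (g * f h) = 0) : ∑ g, F g = 0 := by
  classical
  obtain ⟨T, hT, -⟩ := f.range.exists_isComplement_left 1
  have := Fintype.ofFinite T
  have hbij : Bijective fun x : T × H => (x.1 : G) * f x.2 :=
    hT.comp (bijective_id.prodMap (MonoidHom.ofInjective hf).bijective)
  calc ∑ g, F g = ∑ x : T × H, F (x.1 * f x.2) := (hbij.sum_comp F).symm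
    _ = ∑ t : T, ∑ h, F (t * f h) := Fintype.sum_prod_type _
    _ = 0 := Finset.sum_eq_zero fun t _ => hF t

theorem sum_sign_smul_comp_embedding_smul_eq_zero {β γ M R A : Type*} [Fintype β] [DecidableEq β]
    [Fintype γ] [DecidableEq γ] [Ring R] [AddCommGroup A] [Module R A] (ι : γ ↪ β)
    {g : (γ → M) → R} (hg : ∀ z, ∑ ρ : Perm γ, Perm.sign ρ • g (z ∘ ρ) = 0)
    {h : (β → M) → A} (hh : DependsOn h (Set.range ι)ᶜ) (x : β → M) :
    ∑ σ : Perm β, Perm.sign σ • g ((x ∘ σ) ∘ ι) • h (x ∘ σ) = 0 := by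
  refine sum_eq_zero_of_sum_mul_eq_zero (Perm.viaEmbeddingHom_injective ι) fun σ => ?_
  have hsign (ρ : Perm γ) : Perm.sign (ρ.viaEmbedding ι) = Perm.sign ρ := by
    rw [Perm.viaEmbedding, Perm.sign_extendDomain]
  have hcomp (ρ : Perm γ) : ((x ∘ σ) ∘ ρ.viaEmbedding ι) ∘ ι = ((x ∘ σ) ∘ ι) ∘ ρ :=
    funext fun c => congrArg (x ∘ σ) (ρ.viaEmbedding_apply ι c)
  have hfix (ρ : Perm γ) : h ((x ∘ σ) ∘ ρ.viaEmbedding ι) = h (x ∘ σ) :=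
    hh fun b hb => congrArg (x ∘ σ) (ρ.viaEmbedding_apply_of_notMem ι b hb)
  simp only [Perm.viaEmbeddingHom_apply, Perm.sign_mul, hsign, mul_smul, Perm.coe_mul,
    ← comp_assoc _ σ, hcomp, hfix, ← Finset.smul_sum, ← smul_assoc _ (g _), ← Finset.sum_smul, hg,
    zero_smul, smul_zero]

section CommRing

variable {R M N ι : Type*} [CommRing R] [AddCommGroup M] [Module R M] [AddCommGroup N] [Module R N]
  [DecidableEq ι]

theorem toLinearMap_mem_of_forall_mem {ψ : M [⋀^ι]→ₗ[R] N} {S : Submodule R (M →ₗ[R] N)} (j : ι)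
    (h : ∀ u, ψ.toMultilinearMap.toLinearMap u j ∈ S) (u : ι → M) (i : ι) :
    ψ.toMultilinearMap.toLinearMap u i ∈ S := by
  obtain rfl | hij := eq_or_ne i j
  · exact h u
  have hswap : ψ.toMultilinearMap.toLinearMap (u ∘ swap i j) j =
      -ψ.toMultilinearMap.toLinearMap u i := by
    ext v
    have hu : update (u ∘ swap i j) j v = update u i v ∘ swap i j := by
      rw [update_comp_equiv, symm_swap, swap_apply_left]
    exact (congrArg ψ hu).trans (ψ.map_swap _ hij)
  exact S.neg_mem_iff.mp (hswap ▸ h (u ∘ swap i j))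

theorem toLinearMap_last_eq_snoc_init {n : ℕ} (ψ : M [⋀^Fin (n + 1)]→ₗ[R] N)
    (u : Fin (n + 1) → M) :
    ψ.toMultilinearMap.toLinearMap u (Fin.last n) =
      ψ.toMultilinearMap.toLinearMap (Fin.snoc (Fin.init u) (0 : M) : Fin (n + 1) → M)
        (Fin.last n) := by
  ext v
  simp only [MultilinearMap.toLinearMap_apply, Fin.update_snoc_last]
  conv_lhs => rw [← Fin.snoc_init_self u, Fin.update_snoc_last]

/-- The radical of an alternating map: the vectors on which it vanishes, in whichever slot they
are inserted. -/
def radical (ψ : M [⋀^ι]→ₗ[R] N) : Submodule R M :=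
  ⨅ (u : ι → M) (i : ι), LinearMap.ker (ψ.toMultilinearMap.toLinearMap u i)

theorem mem_radical {ψ : M [⋀^ι]→ₗ[R] N} {v : M} :
    v ∈ radical ψ ↔ ∀ u i, ψ (update u i v) = 0 := by
  simp [radical]

variable [Fintype ι]

theorem sum_compLinearMap_update_apply (L : Module.End R M)
    (f : MultilinearMap R (fun _ : ι => M) N) (x : ι → M) :
    (∑ k, f.compLinearMap (update (fun _ => LinearMap.id) k L)) x =
      ∑ k, f (update x k (L (x k))) := by
  simp only [sum_apply, MultilinearMap.compLinearMap_apply]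
  refine Finset.sum_congr rfl fun k _ => congrArg f <| funext fun i => ?_
  obtain rfl | hik := eq_or_ne i k
  · simp only [update_self]
  · simp only [update_of_ne hik, LinearMap.id_apply]

/-- The Lie derivative `(x₁, …, x_n) ↦ ∑ₖ ψ(x₁, …, L xₖ, …, x_n)` of an alternating map along an
endomorphism, regarded as a linear vector field. -/
def lieDeriv (L : Module.End R M) (ψ : M [⋀^ι]→ₗ[R] N) : M [⋀^ι]→ₗ[R] N :=
  { ∑ k, ψ.toMultilinearMap.compLinearMap (update (fun _ => LinearMap.id) k L) with
    map_eq_zero_of_eq' x i j hx hij := by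
      have hk (k : ι) (hki : k ≠ i ∧ k ≠ j) : ψ (update x k (L (x k))) = 0 := by
        refine ψ.map_eq_zero_of_eq _ ?_ hij
        rw [update_of_ne hki.1.symm, update_of_ne hki.2.symm, hx]
      have hswap : update x i (L (x i)) ∘ swap i j = update x j (L (x j)) := by
        rw [update_comp_equiv, symm_swap, swap_apply_left, comp_swap_eq_update, hx, update_eq_self,
          ← hx, update_eq_self]
      calc _ = ∑ k, ψ (update x k (L (x k))) := sum_compLinearMap_update_apply ..
        _ = ψ (update x i (L (x i))) + ψ (update x j (L (x j))) :=
          Fintype.sum_eq_add i j hij hk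
        _ = 0 := by rw [← hswap, add_comm, ψ.map_swap_add _ hij] }

theorem lieDeriv_apply (L : Module.End R M) (ψ : M [⋀^ι]→ₗ[R] N) (x : ι → M) :
    lieDeriv L ψ x = ∑ k, ψ (update x k (L (x k))) :=
  sum_compLinearMap_update_apply ..

theorem lieDeriv_eq_zero_of_forall_mem_radical {L : Module.End R M} {ψ : M [⋀^ι]→ₗ[R] N}
    (h : ∀ v, L v ∈ radical ψ) : lieDeriv L ψ = 0 := by
  ext x
  simp only [lieDeriv_apply, mem_radical.mp (h _), Finset.sum_const_zero, AlternatingMap.zero_apply]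

/-- The derivations of an alternating bracket: the endomorphisms `L` with
`L [x₁, …, x_n] = ∑ₖ [x₁, …, L xₖ, …, x_n]`. -/
def derivations (φ : M [⋀^ι]→ₗ[R] M) : Submodule R (Module.End R M) where
  carrier := {L | L.compAlternatingMap φ = lieDeriv L φ}
  zero_mem' := by
    ext x
    simp [lieDeriv_apply]
  add_mem' {L L'} h h' := by
    ext x
    simpa [lieDeriv_apply, Finset.sum_add_distrib] using
      congrArg₂ (· + ·) (DFunLike.congr_fun h x) (DFunLike.congr_fun h' x)
  smul_mem' c L h := by
    ext x
    simpa [lieDeriv_apply, Finset.smul_sum] using congrArg (c • ·) (DFunLike.congr_fun h x)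

theorem mem_derivations {φ : M [⋀^ι]→ₗ[R] M} {L : Module.End R M} :
    L ∈ derivations φ ↔ L.compAlternatingMap φ = lieDeriv L φ :=
  Iff.rfl

end CommRing

variable {K V N : Type*} [Field K] [AddCommGroup V] [Module K V] [AddCommGroup N] [Module K N]
  {p q : ℕ}

theorem isNLieBracket_iff_forall_toLinearMap_mem_derivations {n : ℕ}
    {φ : V [⋀^Fin (n + 1)]→ₗ[K] V} :
    IsNLieBracket φ ↔ ∀ u i, φ.toMultilinearMap.toLinearMap u i ∈ derivations φ := by
  have hsnoc (x : Fin n → V) :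
      φ.toMultilinearMap.toLinearMap (Fin.snoc x (0 : V) : Fin (n + 1) → V) (Fin.last n) ∈
        derivations φ ↔ ∀ y, φ (Fin.snoc x (φ y) : Fin (n + 1) → V) =
          ∑ k, φ (update y k (φ (Fin.snoc x (y k) : Fin (n + 1) → V))) := by
    simp [mem_derivations, AlternatingMap.ext_iff, lieDeriv_apply, Fin.update_snoc_last]
  refine ⟨fun h => toLinearMap_mem_of_forall_mem (Fin.last n) fun u => ?_,
    fun h x => (hsnoc x).mp (h _ _)⟩
  rw [toLinearMap_last_eq_snoc_init]
  exact (hsnoc _).mpr (h _)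

theorem IsCompatible.apply_mem_radical {φ : V [⋀^Fin q]→ₗ[K] V} {τ : V [⋀^Fin (p + 1)]→ₗ[K] K}
    (h : IsCompatible φ τ) (x : Fin q → V) : φ x ∈ radical τ := by
  refine mem_radical.mpr <| toLinearMap_mem_of_forall_mem
    (S := LinearMap.ker (LinearMap.applyₗ (φ x))) 0 fun u => ?_
  have hx := h x (Fin.tail u)
  rw [← Fin.update_cons_zero (u 0), Fin.cons_self_tail] at hx
  exact hx

theorem castAdd_ne_natAdd (i : Fin p) (j : Fin q) : Fin.castAdd q i ≠ Fin.natAdd p j :=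
  Fin.ne_of_val_ne (by simp only [Fin.val_castAdd, Fin.val_natAdd]; lia)

theorem outerProduct_update_castAdd (τ : V [⋀^Fin p]→ₗ[K] K) (ψ : V [⋀^Fin q]→ₗ[K] N)
    (x : Fin (p + q) → V) (i : Fin p) (v : V) :
    outerProduct τ ψ (update x (Fin.castAdd q i) v) =
      τ (update (x ∘ Fin.castAdd q) i v) • ψ (x ∘ Fin.natAdd p) := by
  have hl := update_comp_eq_of_injective x (Fin.castAdd_injective p q) i v
  have hr : update x (Fin.castAdd q i) v ∘ Fin.natAdd p = x ∘ Fin.natAdd p :=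
    update_comp_eq_of_forall_ne _ _ fun j => (castAdd_ne_natAdd i j).symm
  rw [← hl, ← hr]
  exact outerProduct_apply ..

theorem outerProduct_update_natAdd (τ : V [⋀^Fin p]→ₗ[K] K) (ψ : V [⋀^Fin q]→ₗ[K] N)
    (x : Fin (p + q) → V) (j : Fin q) (v : V) :
    outerProduct τ ψ (update x (Fin.natAdd p j) v) =
      τ (x ∘ Fin.castAdd q) • ψ (update (x ∘ Fin.natAdd p) j v) := by
  have hl : update x (Fin.natAdd p j) v ∘ Fin.castAdd q = x ∘ Fin.castAdd q :=
    update_comp_eq_of_forall_ne _ _ fun i => castAdd_ne_natAdd i j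
  have hr := update_comp_eq_of_injective x (Fin.natAdd_injective q p) j v
  rw [← hl, ← hr]
  exact outerProduct_apply ..

theorem wedge_apply_eq_sum_outerProduct (τ : V [⋀^Fin p]→ₗ[K] K) (ψ : V [⋀^Fin q]→ₗ[K] N)
    (x : Fin (p + q) → V) :
    wedge τ ψ x = ((q.factorial : K) * (p.factorial : K))⁻¹ •
      ∑ σ : Perm (Fin (p + q)), Perm.sign σ • outerProduct τ ψ (x ∘ σ) := by
  simp only [wedge_apply, outerProduct_apply, comp_apply]

theorem wedge_zero (τ : V [⋀^Fin p]→ₗ[K] K) : wedge τ (0 : V [⋀^Fin q]→ₗ[K] N) = 0 := by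
  ext x
  simp [wedge_apply]

theorem zero_wedge (ψ : V [⋀^Fin q]→ₗ[K] N) : wedge (0 : V [⋀^Fin p]→ₗ[K] K) ψ = 0 := by
  ext x
  simp [wedge_apply]

theorem compAlternatingMap_wedge {N' : Type*} [AddCommGroup N'] [Module K N'] (f : N →ₗ[K] N')
    (τ : V [⋀^Fin p]→ₗ[K] K) (ψ : V [⋀^Fin q]→ₗ[K] N) :
    f.compAlternatingMap (wedge τ ψ) = wedge τ (f.compAlternatingMap ψ) := by
  ext x
  simp [wedge_apply, Units.smul_def]

theorem sum_outerProduct_update_eq_add (L : Module.End K V) (τ : V [⋀^Fin p]→ₗ[K] K)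
    (ψ : V [⋀^Fin q]→ₗ[K] N) (x : Fin (p + q) → V) :
    ∑ k, outerProduct τ ψ (update x k (L (x k))) =
      outerProduct (lieDeriv L τ) ψ x + outerProduct τ (lieDeriv L ψ) x := by
  simp only [Fin.sum_univ_add, outerProduct_update_castAdd, outerProduct_update_natAdd]
  simp only [outerProduct_apply, lieDeriv_apply, Finset.sum_smul, Finset.smul_sum]
  rfl

theorem lieDeriv_wedge (L : Module.End K V) (τ : V [⋀^Fin p]→ₗ[K] K) (ψ : V [⋀^Fin q]→ₗ[K] N) :
    lieDeriv L (wedge τ ψ) = wedge (lieDeriv L τ) ψ + wedge τ (lieDeriv L ψ) := by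
  ext x
  have hσ (σ : Perm (Fin (p + q))) : ∑ k, outerProduct τ ψ (update x k (L (x k)) ∘ σ) =
      outerProduct (lieDeriv L τ) ψ (x ∘ σ) + outerProduct τ (lieDeriv L ψ) (x ∘ σ) := by
    rw [← sum_outerProduct_update_eq_add, ← Equiv.sum_comp σ]
    simp only [update_comp_equiv, symm_apply_apply, comp_apply]
  simp only [lieDeriv_apply, AlternatingMap.add_apply, wedge_apply_eq_sum_outerProduct,
    ← Finset.smul_sum, ← smul_add, ← Finset.sum_add_distrib]
  rw [Finset.sum_comm]
  simp only [← Finset.smul_sum, hσ]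

theorem toLinearMap_wedge (τ : V [⋀^Fin p]→ₗ[K] K) (ψ : V [⋀^Fin q]→ₗ[K] N) (u : Fin (p + q) → V)
    (k : Fin (p + q)) :
    (wedge τ ψ).toMultilinearMap.toLinearMap u k =
      ((q.factorial : K) * (p.factorial : K))⁻¹ • ∑ σ : Perm (Fin (p + q)),
        Perm.sign σ • (outerProduct τ ψ).toLinearMap (u ∘ σ) (σ.symm k) := by
  ext v
  simp [wedge_apply_eq_sum_outerProduct, update_comp_equiv, Units.smul_def]

theorem sum_sign_smul_outerProduct_eq_zero {τ : V [⋀^Fin p]→ₗ[K] K} {ψ : V [⋀^Fin q]→ₗ[K] N}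
    (hpq : (q.factorial : K) * (p.factorial : K) ≠ 0) (h : wedge τ ψ = 0) (x : Fin (p + q) → V) :
    ∑ σ : Perm (Fin (p + q)), Perm.sign σ • outerProduct τ ψ (x ∘ σ) = 0 := by
  have hx := DFunLike.congr_fun h x
  rw [wedge_apply_eq_sum_outerProduct] at hx
  exact (smul_eq_zero.mp hx).resolve_left (inv_ne_zero hpq)

theorem sum_sign_smul_update_eq_zero {τ : V [⋀^Fin p]→ₗ[K] K} (hp : (p.factorial : K) ≠ 0)
    {α : V →ₗ[K] K} (hα : wedge (AlternatingMap.ofSubsingleton K V K (0 : Fin 1) α) τ = 0)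
    (ψ : V [⋀^Fin q]→ₗ[K] N) (w : V) (j : Fin q) (x : Fin (p + q) → V) :
    ∑ σ : Perm (Fin (p + q)), Perm.sign σ • (τ ((x ∘ σ) ∘ Fin.castAdd q) •
      α ((x ∘ σ) (Fin.natAdd p j)) • ψ (update ((x ∘ σ) ∘ Fin.natAdd p) j w)) = 0 := by
  -- The last factor ignores slot `p + j`, so antisymmetrising over slot `p + j` and the first `p`
  -- slots produces the factor `α ∧ τ`.
  let ι : Fin (1 + p) ↪ Fin (p + q) :=
    ⟨Fin.append (fun _ => Fin.natAdd p j) (Fin.castAdd q), Fin.append_injective_iff.mpr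
      ⟨injective_of_subsingleton _, Fin.castAdd_injective p q,
        fun _ i => (castAdd_ne_natAdd i j).symm⟩⟩
  have hιl : ι ∘ Fin.castAdd p = fun _ => Fin.natAdd p j :=
    funext (Fin.append_left (fun _ => Fin.natAdd p j) _)
  have hιr : ι ∘ Fin.natAdd 1 = Fin.castAdd q :=
    funext (Fin.append_right (fun _ : Fin 1 => Fin.natAdd p j) (Fin.castAdd q))
  have hψ : DependsOn (fun y : Fin (p + q) → V => ψ (update (y ∘ Fin.natAdd p) j w))
      (Set.range ι)ᶜ := by
    refine fun y z hyz => congrArg ψ <| funext fun k => ?_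
    obtain rfl | hkj := eq_or_ne k j
    · simp only [update_self]
    simp only [update_of_ne hkj]
    refine hyz _ ?_
    rintro ⟨a, ha⟩
    induction a using Fin.addCases with
    | left i => exact hkj (Fin.natAdd_injective q p (ha.symm.trans (congrFun hιl i)))
    | right i => exact castAdd_ne_natAdd i k ((congrFun hιr i).symm.trans ha)
  have houter (y : Fin (p + q) → V) :
      outerProduct (AlternatingMap.ofSubsingleton K V K (0 : Fin 1) α) τ (y ∘ ι) =
        τ (y ∘ Fin.castAdd q) * α (y (Fin.natAdd p j)) := by
    rw [← hιr, ← congrFun hιl 0, mul_comm]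
    exact outerProduct_apply ..
  have hwedge := sum_sign_smul_outerProduct_eq_zero (by simpa using hp) hα
  simpa only [houter, mul_smul] using
    sum_sign_smul_comp_embedding_smul_eq_zero ι hwedge hψ x

theorem wedge_lieDeriv_smulRight_eq_zero {τ : V [⋀^Fin p]→ₗ[K] K} (hp : (p.factorial : K) ≠ 0)
    {α : V →ₗ[K] K} (hα : wedge (AlternatingMap.ofSubsingleton K V K (0 : Fin 1) α) τ = 0)
    (ψ : V [⋀^Fin q]→ₗ[K] N) (w : V) : wedge τ (lieDeriv (α.smulRight w) ψ) = 0 := by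
  ext x
  simp only [wedge_apply, lieDeriv_apply, LinearMap.smulRight_apply,
    AlternatingMap.map_update_smul, Finset.smul_sum, AlternatingMap.zero_apply]
  rw [Finset.sum_comm]
  simp only [← Finset.smul_sum]
  refine smul_eq_zero_of_right _ <| Finset.sum_eq_zero fun j _ => ?_
  exact sum_sign_smul_update_eq_zero hp hα ψ w j x

theorem mem_derivations_wedge {τ : V [⋀^Fin p]→ₗ[K] K} {φ : V [⋀^Fin q]→ₗ[K] V}
    {L : Module.End K V} (hτ : ∀ v, L v ∈ radical τ) (hφ : L ∈ derivations φ) :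
    L ∈ derivations (wedge τ φ) := by
  rw [mem_derivations, compAlternatingMap_wedge, mem_derivations.mp hφ, lieDeriv_wedge,
    lieDeriv_eq_zero_of_forall_mem_radical hτ, zero_wedge, zero_add]

theorem smulRight_mem_derivations_wedge {τ : V [⋀^Fin p]→ₗ[K] K} {φ : V [⋀^Fin q]→ₗ[K] V}
    (hp : (p.factorial : K) ≠ 0) {α : V →ₗ[K] K}
    (hα : wedge (AlternatingMap.ofSubsingleton K V K (0 : Fin 1) α) τ = 0)
    (hαφ : ∀ x, α (φ x) = 0) {w : V} (hw : w ∈ radical τ) :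
    α.smulRight w ∈ derivations (wedge τ φ) := by
  have hcomp : (α.smulRight w).compAlternatingMap φ = 0 := by
    ext x
    simp [hαφ]
  have hlie : lieDeriv (α.smulRight w) τ = 0 :=
    lieDeriv_eq_zero_of_forall_mem_radical fun v => (radical τ).smul_mem (α v) hw
  rw [mem_derivations, compAlternatingMap_wedge, hcomp, wedge_zero, lieDeriv_wedge, hlie,
    zero_wedge, wedge_lieDeriv_smulRight_eq_zero hp hα, zero_add]

theorem toLinearMap_outerProduct_mem_derivations_wedge {n : ℕ} {φ : V [⋀^Fin (n + 1)]→ₗ[K] V}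
    {τ : V [⋀^Fin (p + 1)]→ₗ[K] K} (hp : ((p + 1).factorial : K) ≠ 0) (hφ : IsNLieBracket φ)
    (hτφ : IsCompatible φ τ) (hτ : ∀ x : Fin p → V, wedge (contract x τ) τ = 0)
    (u : Fin ((p + 1) + (n + 1)) → V) (k : Fin ((p + 1) + (n + 1))) :
    (outerProduct τ φ).toLinearMap u k ∈ derivations (wedge τ φ) := by
  induction k using Fin.addCases with
  | left i =>
    set w := φ (u ∘ Fin.natAdd (p + 1))
    have hslot : (outerProduct τ φ).toLinearMap u (Fin.castAdd (n + 1) i) =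
        (τ.toMultilinearMap.toLinearMap (u ∘ Fin.castAdd (n + 1)) i).smulRight w :=
      LinearMap.ext fun v => outerProduct_update_castAdd τ φ u i v
    rw [hslot]
    refine toLinearMap_mem_of_forall_mem (ψ := τ)
      (S := (derivations (wedge τ φ)).comap (LinearMap.smulRightₗ.flip w)) (Fin.last p)
      (fun u' => ?_) _ i
    refine smulRight_mem_derivations_wedge hp ?_
      (fun x => mem_radical.mp (hτφ.apply_mem_radical x) _ _) (hτφ.apply_mem_radical _)
    rw [toLinearMap_last_eq_snoc_init]
    exact hτ (Fin.init u')
  | right j =>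
    have hslot : (outerProduct τ φ).toLinearMap u (Fin.natAdd (p + 1) j) =
        τ (u ∘ Fin.castAdd (n + 1)) •
          φ.toMultilinearMap.toLinearMap (u ∘ Fin.natAdd (p + 1)) j :=
      LinearMap.ext fun v => outerProduct_update_natAdd τ φ u j v
    rw [hslot]
    exact Submodule.smul_mem _ _ <| mem_derivations_wedge (fun v => hτφ.apply_mem_radical _) <|
      isNLieBracket_iff_forall_toLinearMap_mem_derivations.mp hφ _ _

end NambuLie

open NambuLie in
theorem proposition6p5_general {K V : Type*} [Field K] [AddCommGroup V] [Module K V] {n p : ℕ}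
    (hnp : ((n + 1).factorial : K) * ((p + 1).factorial : K) ≠ 0)
    {φ : V [⋀^Fin (n + 1)]→ₗ[K] V} {τ : V [⋀^Fin (p + 1)]→ₗ[K] K} (hφ : IsNLieBracket φ)
    (hτφ : IsCompatible φ τ) (hτ : ∀ x : Fin p → V, wedge (contract x τ) τ = 0) :
    IsNLieBracket (n := p + 1 + n) (wedge τ φ : V [⋀^Fin ((p + 1) + (n + 1))]→ₗ[K] V) := by
  have hslot (u : Fin ((p + 1) + (n + 1)) → V) (k : Fin ((p + 1) + (n + 1))) :
      (wedge τ φ).toMultilinearMap.toLinearMap u k ∈ derivations (wedge τ φ) := by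
    rw [toLinearMap_wedge]
    exact Submodule.smul_mem _ _ <| Submodule.sum_mem _ fun σ _ =>
      Submodule.smul_of_tower_mem _ _ <| toLinearMap_outerProduct_mem_derivations_wedge
        (right_ne_zero_of_mul hnp) hφ hτφ hτ _ _
  exact isNLieBracket_iff_forall_toLinearMap_mem_derivations.mpr hslot

theorem proposition6p5 {K V : Type*} [Field K] [CharZero K] [AddCommGroup V] [Module K V]
    {n p : ℕ} (φ : V [⋀^Fin (n + 1)]→ₗ[K] V) (τ : V [⋀^Fin (p + 1)]→ₗ[K] K)
    (hφ : NambuLie.IsNLieBracket φ)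
    (hτφ : NambuLie.IsCompatible φ τ)
    (hτ : ∀ x : Fin p → V, NambuLie.wedge (NambuLie.contract x τ) τ = 0) :
    NambuLie.IsNLieBracket (n := p + 1 + n) 
      (NambuLie.wedge τ φ : V [⋀^Fin ((p + 1) + (n + 1))]→ₗ[K] V) :=
  proposition6p5_general (mul_ne_zero (Nat.cast_ne_zero.mpr (Nat.factorial_ne_zero _))
    (Nat.cast_ne_zero.mpr (Nat.factorial_ne_zero _))) hφ hτφ hτ
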